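/- **Setting.** Let $\mathcal X$ be a finite alphabet with $|\mathcal X|\ge 2$, and let $\mathsf M,n\ge 1$ and $\beta\ge 1$ be integers. Each of $n$ noncolluding servers stores the same $\mathsf M$ files $X^{(1)},\dots,X^{(\mathsf M)}\in\mathcal X^{\beta}$, whose symbols are independent and uniform on $\mathcal X$. The index $M$ of the requested file is uniform on $\{1,\dots,\mathsf M\}$. An $(\mathsf M,n)$ information retrieval scheme $\mathcal C$ consists of a random strategy $S$ (where $M$, $S$ and the files are independent), queries $Q_l=\phi_l(M,S)$ with values in finite alphabets $\mathcal Q_l$, answer lengths $\ell_l(Q_l)\in\{0,1,2,\dots\}$, and answers $A_l=\varphi_l(Q_l,X^{(1)},\dots,X^{(\mathsf M)})\in\mathcal A^{\ell_l(Q_l)}$, $1\le l\le n$, over a finite download alphabet $\mathcal A$, such that perfect retrievability holds: $H(X^{(M)}\mid A_1,\dots,A_n,Q_1,\dots,Q_n,M)=0$. Let $\mathcal A_l$ be the set of all words that server $l$ may return. The MI leakage, the download cost and the rate of $\mathcal C$ are $$\rho^{(\mathsf{MI})}(\mathcal C)=\frac1n\sum_{l=1}^n I(M;Q_l),\qquad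 \mathsf D(\mathcal C)=\log_2|\mathcal A|\sum_{l=1}^n\mathbb E[\ell_l(Q_l)],\qquad \mathsf R(\mathcal C)=\frac{\beta\log_2|\mathcal X|}{\mathsf D(\mathcal C)},$$ with entropy and mutual information in bits. Let $H_b^{-1}:[0,1]\to[0,\tfrac12]$ be the inverse of the binary entropy function $H_b(p)=-p\log_2p-(1-p)\log_2(1-p)$ on $[0,\tfrac12]$, and put $H_b^{-1}(y)=0$ for $y<0$. For $\alpha\in\mathbb N$ and $\rho\in\mathbb R$, let $\mathsf R_{\max}^{(\mathsf{MI})}(\beta)$ be the supremum of $\mathsf R(\mathcal C)$ over all $(\mathsf M,n)$ schemes $\mathcal C$ with file length $\beta$ that satisfy $$|\mathcal Q_l|\le\alpha,\qquad |\mathcal A_l|\le|\mathcal X|^{\beta}\qquad(1\le l\le n),\qquad \rho^{(\mathsf{MI})}(\mathcal C)\le\rho$$ (the supremum being $0$ if there is no such scheme). **Theorem.** For every $\beta\ge1$, $$\mathsf R_{\max}^{(\mathsf{MI})}(\beta)\le\left[\frac1{n^{\mathsf M-1}}+2\sum_{m=1}^{\mathsf M-1}\frac1{n^{m-1}}H_b^{-1}(1-\rho)\right]^{-1},$$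 and the same bound holds for large files: $\limsup_{\beta\to\infty}\mathsf R_{\max}^{(\mathsf{MI})}(\beta)$ is at most the right-hand side. -/

import Mathlib

open MeasureTheory ProbabilityTheory Filter
open scoped ENNReal

universe u v

noncomputable section

namespace WPIR

/-! ### Information measures of discrete random variables, in bits

All random variables below take only finitely many values, so that each sum over an alphabet has
finitely many nonzero terms. -/

section Entropy

variable {Ω : Type*} [MeasurableSpace Ω] {𝒴 : Type*} {𝒵 : Type*}

/-- The entropy `H(Y) = - ∑ y, P(Y = y) log₂ P(Y = y)`. -/
def entropy (P : Measure Ω) (Y : Ω → 𝒴) : ℝ :=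
  ∑' y, Real.negMulLog (P.real (Y ⁻¹' {y})) / Real.log 2

/-- The conditional entropy `H(Y | Z) = ∑ z, P(Z = z) H(Y | Z = z)`, where
`P(Y = y | Z = z) = P(Y = y, Z = z) / P(Z = z)`. -/
def condEntropy (P : Measure Ω) (Y : Ω → 𝒴) (Z : Ω → 𝒵) : ℝ :=
  ∑' z, P.real (Z ⁻¹' {z}) *
    ∑' y, Real.negMulLog (P.real (Y ⁻¹' {y} ∩ Z ⁻¹' {z}) / P.real (Z ⁻¹' {z})) / Real.log 2

/-- The mutual information `I(Y ; Z) = H(Y) - H(Y | Z)`. -/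
def mutualInfo (P : Measure Ω) (Y : Ω → 𝒴) (Z : Ω → 𝒵) : ℝ :=
  entropy P Y - condEntropy P Y Z

end Entropy

/-- The binary entropy function `H_b(p) = - p log₂ p - (1 - p) log₂ (1 - p)`. -/
def binEntropy₂ (p : ℝ) : ℝ :=
  Real.binEntropy p / Real.log 2

/-- The inverse `H_b⁻¹ : [0, 1] → [0, 1/2]` of the binary entropy function, extended by the value
`0` to negative arguments. -/
def binEntropyInv (y : ℝ) : ℝ :=
  sInf {p : ℝ | 0 ≤ p ∧ p ≤ 1 / 2 ∧ y ≤ binEntropy₂ p}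

/-! ### Information retrieval schemes -/

/-- The contents of the database: `M` files, each of them a vector of `β` symbols of `𝒳`. -/
def Files (𝒳 : Type v) (M β : ℕ) : Type v := Fin M → Fin β → 𝒳

instance (𝒳 : Type v) (M β : ℕ) : MeasurableSpace (Files 𝒳 M β) := ⊤

/-- The data of an information retrieval protocol for `M` files of length `β` over `𝒳`, stored on
each of `n` servers: a random strategy `S` with its law, query functions `Q_l = φ_l(m, S)` with
values in finite alphabets, answer lengths `ℓ_l(Q_l)`, and answer functions, whose value
`A_l = φ_l(Q_l, X)` is a word of length `ℓ_l(Q_l)` over a finite download symbol alphabet. -/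
structure IRProtocol (𝒳 : Type v) (M n β : ℕ) where
  Strategy : Type u
  [measurableSpaceStrategy : MeasurableSpace Strategy]
  law : Measure Strategy
  [isProbabilityMeasure_law : IsProbabilityMeasure law]
  Query : Fin n → Type u
  [fintypeQuery : ∀ l, Fintype (Query l)]
  query : ∀ l, Fin M → Strategy → Query l
  measurableSet_query : ∀ l m q, MeasurableSet {s | query l m s = q}
  Symbol : Type u
  [fintypeSymbol : Fintype Symbol]
  answerLength : ∀ l, Query l → ℕ
  answer : ∀ l, Query l → Files 𝒳 M β → List Symbol
  length_answer : ∀ l q x, (answer l q x).length = answerLength l q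

namespace IRProtocol

attribute [instance] measurableSpaceStrategy isProbabilityMeasure_law fintypeQuery fintypeSymbol

variable {𝒳 : Type v} {M n β : ℕ} (C : IRProtocol.{u} 𝒳 M n β)

/-- The sample space; an outcome consists of the requested index, the strategy, and the files. -/
abbrev Outcome : Type _ := Fin M × C.Strategy × Files 𝒳 M β

/-- The probability on the sample space: the requested index is uniform, the strategy has the law
of the protocol, the symbols of the files are independent and uniform, and these three components
are independent. -/
def prob : Measure C.Outcome :=
  (uniformOn (Set.univ : Set (Fin M))).prod
    (C.law.prod (uniformOn (Set.univ : Set (Files 𝒳 M β))))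

/-- The index of the requested file. -/
def index (ω : C.Outcome) : Fin M := ω.1

/-- The query sent to server `l`. -/
def Q (l : Fin n) (ω : C.Outcome) : C.Query l := C.query l ω.1 ω.2.1

/-- The answer of server `l`. -/
def A (l : Fin n) (ω : C.Outcome) : List C.Symbol := C.answer l (C.Q l ω) ω.2.2

/-- The requested file. -/
def requestedFile (ω : C.Outcome) : Fin β → 𝒳 := ω.2.2 ω.1

/-- Perfect retrievability: the requested file has zero conditional entropy given all answers, all
queries and the requested index. -/
def PerfectRetrievability : Prop :=
  condEntropy C.prob C.requestedFile
    (fun ω => ((fun l => C.A l ω), (fun l => C.Q l ω), C.index ω)) = 0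

/-- The leakage in terms of mutual information, `(1 / n) ∑ l, I(index ; Q_l)`. -/
def leakageMI : ℝ :=
  (1 / (n : ℝ)) * ∑ l, mutualInfo C.prob C.index (C.Q l)

/-- The download cost, `log₂ |𝒜| ∑ l, E[ℓ_l(Q_l)]`. -/
def downloadCost : ℝ :=
  Real.logb 2 (Fintype.card C.Symbol) * ∑ l, ∫ ω, (C.answerLength l (C.Q l ω) : ℝ) ∂C.prob

/-- The rate, `β log₂ |𝒳| / D`. It is `∞` if `D = 0` and `β log₂ |𝒳| > 0`. -/
def rate [Fintype 𝒳] : ℝ≥0∞ :=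
  ENNReal.ofReal (β * Real.logb 2 (Fintype.card 𝒳)) / ENNReal.ofReal C.downloadCost

/-- The alphabet of the answer of server `l`: all words that the server may return. -/
def answerAlphabet (l : Fin n) : Set (List C.Symbol) :=
  {w | ∃ q x, C.answer l q x = w}

end IRProtocol

/-- An `(M, n)` information retrieval scheme. -/
structure IRScheme (𝒳 : Type v) (M n β : ℕ) extends IRProtocol.{u} 𝒳 M n β where
  retrievable : toIRProtocol.PerfectRetrievability

/-- The alphabet restrictions `|𝒬_l| ≤ α` and `|𝒜_l| ≤ |𝒳| ^ β` for every server. -/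
def IRScheme.RestrictedAlphabets {𝒳 : Type v} [Fintype 𝒳] {M n β : ℕ}
    (C : IRScheme.{u} 𝒳 M n β) (α : ℕ) : Prop :=
  ∀ l, Fintype.card (C.Query l) ≤ α ∧
    (C.answerAlphabet l).encard ≤ ((Fintype.card 𝒳 ^ β : ℕ) : ℕ∞)

/-- The maximum possible rate for files of length `β`: the supremum of the rates of the schemes
with restricted alphabets whose leakage is at most `ρ`. -/
def maxRateMI (𝒳 : Type v) [Fintype 𝒳] (M n α : ℕ) (ρ : ℝ) (β : ℕ) : ℝ≥0∞ :=
  ⨆ C : {C : IRScheme.{u} 𝒳 M n β // C.RestrictedAlphabets α ∧ C.leakageMI ≤ ρ}, C.1.rate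

/-- The upper bound
`[1 / n ^ (M - 1) + 2 ∑_{m = 1}^{M - 1} (1 / n ^ (m - 1)) H_b⁻¹(1 - ρ)]⁻¹`, for `M ≥ 1`. -/
def rateUpperBoundMI (M n : ℕ) (ρ : ℝ) : ℝ :=
  (1 / (n : ℝ) ^ (M - 1) +
    2 * ∑ m ∈ Finset.Icc 1 (M - 1), 1 / (n : ℝ) ^ (m - 1) * binEntropyInv (1 - ρ))⁻¹

end WPIR

end

/-! Condition on the requested index and on the queries: the files remain uniform, so each answer is
a partition of the finite set of database contents, and entropies reduce to averages of logarithms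
of class sizes (`condEnt`). Let L be the entropy of one file and let G(K, m) be the sum over the
servers of the expected entropies of their answers, given the files in K, when file m is requested.

Retrieval. If i is not in K, the joint answer determines file i. By the chain rule its entropy given
K is L plus its entropy given K and i; the latter dominates that of every single answer, hence their
mean. So L + G(K ∪ {i}, i) / n ≤ G(K, i) (`le_answerEnt`).

Change of request. Each answer has entropy in [0, L], by the bound on the answer alphabets.
Replacing the query law of i by that of i + 1 therefore costs at most L times their total variation
distance, per server. Averaged over i in cyclic order, one step gains L times `overlap`, the mean of
∑ min of consecutive query laws (`sum_answerEnt_step`). Iterating over all files bounds the download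
from below.

Leakage. Choose a uniform edge J = (m, m + 1) of the cycle of requests and let the request be a
uniform endpoint. Then H(index | J, Q) = H(index | Q) + log 2 - H(J | Q) ≥ log 2 - I(index ; Q),
because H(J | Q) ≤ log M. The left side is a mean of binary entropies of posteriors, so by Jensen
its average over the servers is at most the binary entropy of `overlap / 2`
(`log_two_sub_le_binEntropy_overlap`). Hence `overlap` is at least 2 H_b⁻¹(1 - ρ). -/

namespace WPIR

/-! ### Conditional entropy of partitions of a finite set under the uniform distribution -/

section Partition

variable {F : Type*} [Fintype F]

open Classical in
/-- The number of elements of the class of `x`. -/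
noncomputable def classSize (s : Setoid F) (x : F) : ℕ :=
  (Finset.univ.filter fun y => s y x).card

/-- The conditional entropy, in nats, of the class of a uniform random element of `F` with respect
to `s`, given its class with respect to `t`. -/
noncomputable def condEnt (s t : Setoid F) : ℝ :=
  (∑ x, (Real.log (classSize t x) - Real.log (classSize (s ⊓ t) x))) / Fintype.card F

theorem classSize_pos (s : Setoid F) (x : F) : 0 < classSize s x := by
  classical
  exact Finset.card_pos.2 ⟨x, by simp⟩

theorem classSize_mono {s t : Setoid F} (h : s ≤ t) (x : F) : classSize s x ≤ classSize t x := by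
  classical
  refine Finset.card_le_card fun y hy => ?_
  simp only [Finset.mem_filter, Finset.mem_univ, true_and] at hy ⊢
  exact h hy

theorem classSize_congr {s : Setoid F} {x y : F} (h : s x y) : classSize s x = classSize s y := by
  classical
  unfold classSize
  congr 1
  ext z
  simp only [Finset.mem_filter, Finset.mem_univ, true_and]
  exact ⟨fun hz => s.trans hz h, fun hz => s.trans hz (s.symm h)⟩

theorem log_classSize_mono {s t : Setoid F} (h : s ≤ t) (x : F) :
    Real.log (classSize s x) ≤ Real.log (classSize t x) :=
  Real.log_le_log (by exact_mod_cast classSize_pos s x) (by exact_mod_cast classSize_mono h x)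

theorem condEnt_nonneg (s t : Setoid F) : 0 ≤ condEnt s t :=
  div_nonneg (Finset.sum_nonneg fun x _ => sub_nonneg.2 (log_classSize_mono inf_le_right x))
    (Nat.cast_nonneg _)

/-- Setoids are ordered by refinement, so the smaller setoid is the finer partition and carries more
information. -/
theorem condEnt_anti {s s' : Setoid F} (h : s ≤ s') (t : Setoid F) :
    condEnt s' t ≤ condEnt s t := by
  unfold condEnt
  gcongr
  · exact_mod_cast classSize_pos _ _
  · exact classSize_mono (inf_le_inf_right t h) _

theorem condEnt_top_left (t : Setoid F) : condEnt ⊤ t = 0 := by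
  simp [condEnt]

/-- The chain rule for a partition `r` that is coarser than `s`. -/
theorem condEnt_eq_add {s r : Setoid F} (h : s ≤ r) (t : Setoid F) :
    condEnt s t = condEnt r t + condEnt s (r ⊓ t) := by
  unfold condEnt
  rw [← add_div, ← Finset.sum_add_distrib, ← inf_assoc, inf_eq_left.2 h]
  congr 1
  exact Finset.sum_congr rfl fun x _ => by ring

/-- The summand is constant on `A`, which sits inside one class. This count is what bounds the sums
of ratios in the two entropy inequalities below. -/
theorem sum_inv_classSize_le_one (s : Setoid F) (A : Finset F)
    (hA : ∀ x ∈ A, ∀ y ∈ A, s x y) : ∑ x ∈ A, (1 / (classSize s x : ℝ)) ≤ 1 := by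
  classical
  rcases A.eq_empty_or_nonempty with rfl | ⟨x₀, h₀⟩
  · simp
  have hc : ∑ x ∈ A, (1 / (classSize s x : ℝ)) = A.card * (1 / (classSize s x₀ : ℝ)) := by
    rw [← nsmul_eq_mul, ← Finset.sum_const]
    exact Finset.sum_congr rfl fun x hx => by rw [classSize_congr (hA x hx x₀ h₀)]
  rw [hc, mul_one_div, div_le_one (by exact_mod_cast classSize_pos s x₀)]
  have : A.card ≤ classSize s x₀ :=
    Finset.card_le_card fun x hx => by simpa using hA x hx x₀ h₀
  exact_mod_cast this

open Classical in
theorem classSize_eq_sum (s : Setoid F) (x : F) :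
    (classSize s x : ℝ) = ∑ y, if s y x then 1 else 0 := by
  simp [classSize]

/-- Gibbs' inequality: apply log u ≤ u - 1 to the ratio u of the product of the conditional class
probabilities to the joint one. It remains to see that these ratios have mean at most 1. -/
theorem condEnt_inf_le (s₁ s₂ t : Setoid F) :
    condEnt (s₁ ⊓ s₂) t ≤ condEnt s₁ t + condEnt s₂ t := by
  classical
  unfold condEnt
  rw [← add_div, ← Finset.sum_add_distrib]
  refine div_le_div_of_nonneg_right ?_ (Nat.cast_nonneg _)
  have key : ∑ x, ((classSize (s₁ ⊓ t) x : ℝ) * classSize (s₂ ⊓ t) x *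
      (1 / classSize t x * (1 / classSize (s₁ ⊓ s₂ ⊓ t) x))) ≤ ∑ _x : F, (1 : ℝ) := by
    -- Class sizes are written as counts of y and z, and x is summed first. For fixed y and z the
    -- admissible x lie in a single class of `s₁ ⊓ s₂ ⊓ t`, and there are none unless y and z are
    -- `t`-equivalent.
    calc ∑ x, ((classSize (s₁ ⊓ t) x : ℝ) * classSize (s₂ ⊓ t) x *
          (1 / classSize t x * (1 / classSize (s₁ ⊓ s₂ ⊓ t) x)))
        = ∑ x, ∑ y, ∑ z, (if (s₁ ⊓ t) y x then 1 else 0) * (if (s₂ ⊓ t) z x then 1 else 0) *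
          (1 / (classSize t x : ℝ) * (1 / classSize (s₁ ⊓ s₂ ⊓ t) x)) := by
          refine Finset.sum_congr rfl fun x _ => ?_
          rw [classSize_eq_sum (s₁ ⊓ t), classSize_eq_sum (s₂ ⊓ t), Finset.sum_mul_sum,
            Finset.sum_mul]
          simp only [Finset.sum_mul]
      _ = ∑ y, ∑ z, ∑ x, (if (s₁ ⊓ t) y x then 1 else 0) * (if (s₂ ⊓ t) z x then 1 else 0) *
          (1 / (classSize t x : ℝ) * (1 / classSize (s₁ ⊓ s₂ ⊓ t) x)) := by
          rw [Finset.sum_comm]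
          exact Finset.sum_congr rfl fun y _ => Finset.sum_comm
      _ ≤ ∑ y, ∑ z, (if t z y then 1 else 0) * (1 / (classSize t y : ℝ)) := by
          refine Finset.sum_le_sum fun y _ => Finset.sum_le_sum fun z _ => ?_
          by_cases hzy : t z y
          · rw [if_pos hzy, one_mul]
            calc _ = ∑ x ∈ Finset.univ.filter (fun x => (s₁ ⊓ t) y x ∧ (s₂ ⊓ t) z x),
                  1 / (classSize t y : ℝ) * (1 / classSize (s₁ ⊓ s₂ ⊓ t) x) := by
                  rw [Finset.sum_filter]
                  refine Finset.sum_congr rfl fun x _ => ?_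
                  by_cases h1 : (s₁ ⊓ t) y x
                  · by_cases h2 : (s₂ ⊓ t) z x
                    · simp only [h1, h2, and_self, if_true, one_mul]
                      rw [classSize_congr h1.2]
                    · simp [h2]
                  · simp [h1]
              _ ≤ 1 / (classSize t y : ℝ) * 1 := by
                  rw [← Finset.mul_sum]
                  refine mul_le_mul_of_nonneg_left (sum_inv_classSize_le_one _ _ ?_)
                    (by positivity)
                  intro x hx x' hx'
                  simp only [Finset.mem_filter, Finset.mem_univ, true_and] at hx hx'
                  exact ⟨⟨s₁.trans (s₁.symm hx.1.1) hx'.1.1, s₂.trans (s₂.symm hx.2.1) hx'.2.1⟩,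
                    t.trans (t.symm hx.1.2) hx'.1.2⟩
              _ = _ := mul_one _
          · rw [if_neg hzy, zero_mul]
            refine (Finset.sum_eq_zero fun x _ => ?_).le
            by_cases h1 : (s₁ ⊓ t) y x
            · have h2 : ¬ (s₂ ⊓ t) z x := fun h2 => hzy (t.trans h2.2 (t.symm h1.2))
              simp [h2]
            · simp [h1]
      _ = ∑ _x : F, (1 : ℝ) := by
          refine Finset.sum_congr rfl fun y _ => ?_
          rw [← Finset.sum_mul, ← classSize_eq_sum]
          have : (classSize t y : ℝ) ≠ 0 := by exact_mod_cast (classSize_pos t y).ne'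
          field_simp
  rw [← sub_nonneg, ← Finset.sum_sub_distrib]
  have hle : ∑ x, (1 - (classSize (s₁ ⊓ t) x : ℝ) * classSize (s₂ ⊓ t) x *
      (1 / classSize t x * (1 / classSize (s₁ ⊓ s₂ ⊓ t) x))) ≤
      ∑ x, (Real.log (classSize t x) - Real.log (classSize (s₁ ⊓ t) x) +
        (Real.log (classSize t x) - Real.log (classSize (s₂ ⊓ t) x)) -
        (Real.log (classSize t x) - Real.log (classSize (s₁ ⊓ s₂ ⊓ t) x))) := by
    refine Finset.sum_le_sum fun x _ => ?_
    have p1 : (0 : ℝ) < classSize (s₁ ⊓ t) x := by exact_mod_cast classSize_pos _ _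
    have p2 : (0 : ℝ) < classSize (s₂ ⊓ t) x := by exact_mod_cast classSize_pos _ _
    have p3 : (0 : ℝ) < classSize t x := by exact_mod_cast classSize_pos _ _
    have p4 : (0 : ℝ) < classSize (s₁ ⊓ s₂ ⊓ t) x := by exact_mod_cast classSize_pos _ _
    have := Real.log_le_sub_one_of_pos (x := (classSize (s₁ ⊓ t) x : ℝ) * classSize (s₂ ⊓ t) x *
      (1 / classSize t x * (1 / classSize (s₁ ⊓ s₂ ⊓ t) x))) (by positivity)
    rw [Real.log_mul (by positivity) (by positivity), Real.log_mul p1.ne' p2.ne',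
      Real.log_mul (by positivity) (by positivity), one_div, one_div, Real.log_inv,
      Real.log_inv] at this
    simp only [one_div] at this ⊢
    linarith
  refine le_trans ?_ hle
  rw [Finset.sum_sub_distrib]
  exact sub_nonneg.2 key

theorem condEnt_finset_inf_le {ι : Type*} (S : Finset ι) (s : ι → Setoid F) (t : Setoid F) :
    condEnt (S.inf s) t ≤ ∑ l ∈ S, condEnt (s l) t := by
  classical
  induction S using Finset.induction_on with
  | empty => simp [condEnt_top_left]
  | insert i S hi ih =>
    rw [Finset.inf_insert, Finset.sum_insert hi]
    exact (condEnt_inf_le _ _ _).trans (by gcongr)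

/-- Again log u ≤ u - 1, now comparing with the uniform law on k values: each `t`-class splits into
at most k classes of `ker f ⊓ t`, and each of these contributes at most 1 to the sum of inverse
sizes. -/
theorem condEnt_ker_le_log [Nonempty F] {γ : Type*} (f : F → γ) (t : Setoid F) (k : ℕ)
    (hk : (Set.range f).ncard ≤ k) : condEnt (Setoid.ker f) t ≤ Real.log k := by
  classical
  have hr : (Finset.univ.image f).card ≤ k := by
    rwa [← Set.ncard_coe_finset, Finset.coe_image, Finset.coe_univ, Set.image_univ]
  have hk0 : (0 : ℝ) < k := by
    have : 0 < (Finset.univ.image f).card :=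
      Finset.card_pos.2 (Finset.univ_nonempty.image f)
    exact_mod_cast this.trans_le hr
  have key : ∑ x, ((classSize t x : ℝ) * (1 / classSize (Setoid.ker f ⊓ t) x)) ≤
      ∑ _x : F, (k : ℝ) := by
    calc ∑ x, ((classSize t x : ℝ) * (1 / classSize (Setoid.ker f ⊓ t) x))
        = ∑ y, ∑ x, (if t y x then 1 else 0) *
            (1 / (classSize (Setoid.ker f ⊓ t) x : ℝ)) := by
          rw [Finset.sum_comm]
          refine Finset.sum_congr rfl fun x _ => ?_
          rw [classSize_eq_sum t, Finset.sum_mul]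
      _ ≤ ∑ _y : F, (k : ℝ) := by
          refine Finset.sum_le_sum fun y _ => ?_
          calc _ = ∑ x ∈ Finset.univ.filter (fun x => t y x),
                (1 / (classSize (Setoid.ker f ⊓ t) x : ℝ)) := by
                rw [Finset.sum_filter]
                exact Finset.sum_congr rfl fun x _ => by split_ifs <;> simp
            _ = ∑ a ∈ Finset.univ.image f, ∑ x ∈ Finset.univ.filter (fun x => t y x) with f x = a,
                (1 / (classSize (Setoid.ker f ⊓ t) x : ℝ)) := by
                refine (Finset.sum_fiberwise_of_maps_to (fun x _ => ?_) _).symm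
                exact Finset.mem_image_of_mem f (Finset.mem_univ x)
            _ ≤ ∑ a ∈ Finset.univ.image f, 1 := by
                refine Finset.sum_le_sum fun a _ => sum_inv_classSize_le_one _ _ ?_
                intro x hx x' hx'
                simp only [Finset.mem_filter, Finset.mem_univ, true_and] at hx hx'
                exact ⟨hx.2.trans hx'.2.symm, t.trans (t.symm hx.1) hx'.1⟩
            _ ≤ k := by simpa using hr
  unfold condEnt
  rw [div_le_iff₀ (by exact_mod_cast Fintype.card_pos)]
  have hle : ∑ x, (Real.log (classSize t x) - Real.log (classSize (Setoid.ker f ⊓ t) x)) ≤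
      ∑ x, ((classSize t x : ℝ) * (1 / classSize (Setoid.ker f ⊓ t) x) / k - 1 + Real.log k) := by
    refine Finset.sum_le_sum fun x _ => ?_
    have p3 : (0 : ℝ) < classSize t x := by exact_mod_cast classSize_pos _ _
    have p4 : (0 : ℝ) < classSize (Setoid.ker f ⊓ t) x := by exact_mod_cast classSize_pos _ _
    have := Real.log_le_sub_one_of_pos
      (x := (classSize t x : ℝ) * (1 / classSize (Setoid.ker f ⊓ t) x) / k) (by positivity)
    rw [Real.log_div (by positivity) hk0.ne', Real.log_mul p3.ne' (by positivity), one_div,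
      Real.log_inv] at this
    rw [one_div]
    linarith
  refine hle.trans ?_
  rw [Finset.sum_add_distrib, Finset.sum_sub_distrib, ← Finset.sum_div]
  have : (∑ x, ((classSize t x : ℝ) * (1 / classSize (Setoid.ker f ⊓ t) x))) / k ≤
      ∑ _x : F, (1 : ℝ) := by
    rw [div_le_iff₀ hk0, Finset.sum_mul]
    simpa using key
  simp only [Finset.sum_const, Finset.card_univ, nsmul_eq_mul] at this ⊢
  linarith

end Partition

/-! ### Independence of the files -/

section Files

theorem setoid_finset_inf_iff {ι F : Type*} (S : Finset ι) (s : ι → Setoid F) (x y : F) :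
    S.inf s x y ↔ ∀ i ∈ S, s i x y := by
  classical
  induction S using Finset.induction_on with
  | empty => exact iff_of_true trivial (by simp)
  | insert i S hi ih => rw [Finset.inf_insert, Setoid.inf_iff_and, ih, Finset.forall_mem_insert]

variable {ι V : Type*}

/-- The partition of the contents of a database according to the files with index in `K`. -/
def known (V : Type*) (K : Finset ι) : Setoid (ι → V) :=
  K.inf fun i => Setoid.ker fun x => x i

theorem known_iff (K : Finset ι) (x y : ι → V) : known V K x y ↔ ∀ i ∈ K, x i = y i :=
  setoid_finset_inf_iff K _ x y

theorem known_insert [DecidableEq ι] (K : Finset ι) (i : ι) :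
    known V (insert i K) = Setoid.ker (fun x : ι → V => x i) ⊓ known V K :=
  Finset.inf_insert

/-- The class of x is a box: coordinates in `K` are fixed and the others are free. -/
theorem log_classSize_known [Fintype ι] [DecidableEq ι] [Fintype V] [Nonempty V] (K : Finset ι) (x : ι → V) :
    Real.log (classSize (known V K) x) =
      ∑ i, if i ∈ K then 0 else Real.log (Fintype.card V) := by
  classical
  have : (Finset.univ.filter fun y => known V K y x) =
      Fintype.piFinset fun i => if i ∈ K then {x i} else Finset.univ := by
    ext y
    simp only [Finset.mem_filter, Finset.mem_univ, true_and, known_iff, Fintype.mem_piFinset]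
    refine forall_congr' fun i => ?_
    split_ifs with h <;> simp [h]
  rw [classSize, this, Fintype.card_piFinset, Nat.cast_prod, Real.log_prod]
  · refine Finset.sum_congr rfl fun i _ => ?_
    split_ifs <;> simp
  · intro i _
    split_ifs <;> simp

theorem condEnt_file_known [Fintype ι] [DecidableEq ι] [Fintype V] [Nonempty V] {K : Finset ι}
    {i : ι} (hi : i ∉ K) :
    condEnt (Setoid.ker fun x : ι → V => x i) (known V K) = Real.log (Fintype.card V) := by
  have h : ∀ x : ι → V, Real.log (classSize (known V K) x) -
      Real.log (classSize (Setoid.ker (fun x : ι → V => x i) ⊓ known V K) x) =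
      Real.log (Fintype.card V) := by
    intro x
    rw [← known_insert, log_classSize_known, log_classSize_known, ← Finset.sum_sub_distrib,
      Finset.sum_eq_single i]
    · simp [hi]
    · intro j _ hj
      simp [hj]
    · simp
  rw [condEnt, Finset.sum_congr rfl fun x _ => h x, Finset.sum_const, Finset.card_univ,
    nsmul_eq_mul, mul_div_cancel_left₀]
  exact_mod_cast Fintype.card_ne_zero

end Files

/-! ### Converse bound in terms of the overlap of query laws -/

section Converse

/-- The inequality for the weighted means of a function with values in `[0, L]` under two weight
functions of total mass one. -/
theorem sum_mul_sub_le_sum_mul {Q : Type*} [Fintype Q] {a b h : Q → ℝ} {L : ℝ}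
    (hb : ∑ q, b q = 1) (h0 : ∀ q, 0 ≤ h q) (hL : ∀ q, h q ≤ L) :
    ∑ q, b q * h q - L * (1 - ∑ q, min (a q) (b q)) ≤ ∑ q, a q * h q := by
  have : ∑ q, ((b q - a q) * h q) ≤ ∑ q, L * (b q - min (a q) (b q)) := by
    refine Finset.sum_le_sum fun q _ => ?_
    rcases le_total (a q) (b q) with hq | hq
    · rw [min_eq_left hq, mul_comm L]
      exact mul_le_mul_of_nonneg_left (hL q) (by linarith)
    · rw [min_eq_right hq, sub_self, mul_zero]
      exact mul_nonpos_of_nonpos_of_nonneg (by linarith) (h0 q)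
  rw [← Finset.mul_sum, Finset.sum_sub_distrib, hb] at this
  simp only [sub_mul, Finset.sum_sub_distrib] at this
  linarith

variable {M n : ℕ} {V : Type*} [Fintype V] {Query : Fin n → Type*}
  [∀ l, Fintype (Query l)]

/-- The sum over the servers of the conditional entropies of the answers given the files with index
in `K`, where the queries are distributed as for the request of file `m`. -/
noncomputable def answerEnt (ans : ∀ l, Query l → Setoid (Fin M → V))
    (a : ∀ l, Fin M → Query l → ℝ) (K : Finset (Fin M)) (m : Fin M) : ℝ :=
  ∑ l, ∑ q, a l m q * condEnt (ans l q) (known V K)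

variable {ans : ∀ l, Query l → Setoid (Fin M → V)} {a : ∀ l, Fin M → Query l → ℝ}

theorem answerEnt_nonneg (ha : ∀ l m q, 0 ≤ a l m q) (K : Finset (Fin M)) (m : Fin M) :
    0 ≤ answerEnt ans a K m :=
  Finset.sum_nonneg fun l _ => Finset.sum_nonneg fun q _ =>
    mul_nonneg (ha l m q) (condEnt_nonneg _ _)

/-- The change of the request from `j` to `i`, for answers with entropy at most that of a file. -/
theorem answerEnt_sub_le (ha : ∀ l m, ∑ q, a l m q = 1)
    (hans : ∀ l q t, condEnt (ans l q) t ≤ Real.log (Fintype.card V))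
    (K : Finset (Fin M)) (i j : Fin M) :
    answerEnt ans a K j - Real.log (Fintype.card V) *
      ∑ l, (1 - ∑ q, min (a l i q) (a l j q)) ≤ answerEnt ans a K i := by
  unfold answerEnt
  rw [Finset.mul_sum, ← Finset.sum_sub_distrib]
  exact Finset.sum_le_sum fun l _ => sum_mul_sub_le_sum_mul (ha l j)
    (fun q => condEnt_nonneg _ _) (fun q => hans l q _)

variable [∀ l, DecidableEq (Query l)]

theorem sum_marginal_mul {p : (∀ l, Query l) → ℝ} {l : Fin n} {b : Query l → ℝ}
    (hb : ∀ q, b q = ∑ r : ∀ l, Query l, if r l = q then p r else 0) (f : Query l → ℝ) :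
    ∑ q, b q * f q = ∑ r, p r * f (r l) := by
  simp only [hb, Finset.sum_mul]
  rw [Finset.sum_comm]
  refine Finset.sum_congr rfl fun r _ => ?_
  simp [ite_mul]

/-- Retrievability of file `i`: the answers contain file `i` and all that each single answer
contains about the other files. -/
theorem le_answerEnt [Nonempty V] (hn : 1 ≤ n) {p : Fin M → (∀ l, Query l) → ℝ}
    (hp : ∀ m r, 0 ≤ p m r) (hp1 : ∀ m, ∑ r, p m r = 1)
    (hap : ∀ l m q, a l m q = ∑ r : ∀ l, Query l, if r l = q then p m r else 0)
    (hret : ∀ m r, 0 < p m r →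
      Finset.univ.inf (fun l => ans l (r l)) ≤ Setoid.ker fun x : Fin M → V => x m)
    {K : Finset (Fin M)} {i : Fin M} (hi : i ∉ K) :
    Real.log (Fintype.card V) + answerEnt ans a (insert i K) i / n ≤ answerEnt ans a K i := by
  have hG : ∀ K, answerEnt ans a K i =
      ∑ r, p i r * ∑ l, condEnt (ans l (r l)) (known V K) := by
    intro K
    unfold answerEnt
    simp only [Finset.mul_sum]
    rw [Finset.sum_comm]
    exact Finset.sum_congr rfl fun l _ => sum_marginal_mul (hap l i) _
  have hn' : (0 : ℝ) < n := by exact_mod_cast hn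
  rw [hG, hG, ← one_mul (Real.log _), ← hp1 i, Finset.sum_mul, Finset.sum_div,
    ← Finset.sum_add_distrib]
  refine Finset.sum_le_sum fun r _ => ?_
  rw [mul_div_assoc, ← mul_add]
  rcases (hp i r).eq_or_lt with h0 | h0
  · simp [← h0]
  refine mul_le_mul_of_nonneg_left ?_ (hp i r)
  refine le_trans ?_ (condEnt_finset_inf_le Finset.univ (fun l => ans l (r l)) (known V K))
  rw [condEnt_eq_add (hret i r h0), condEnt_file_known hi, ← known_insert]
  gcongr
  rw [div_le_iff₀ hn']
  -- The joint partition refines each of the n single ones; averaging over the servers produces the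
  -- factor 1 / n.
  calc _ ≤ ∑ _l : Fin n, condEnt (Finset.univ.inf fun l => ans l (r l)) (known V (insert i K)) :=
        Finset.sum_le_sum fun l _ => condEnt_anti (Finset.inf_le (Finset.mem_univ l)) _
    _ = _ := by simp [mul_comm]

/-- The average overlap of the distributions of a query for two cyclically consecutive requests. -/
noncomputable def overlap [NeZero M] (a : ∀ l, Fin M → Query l → ℝ) : ℝ :=
  (∑ l, ∑ m, ∑ q, min (a l m q) (a l (m + 1) q)) / (n * M)

/-- Retrieval of file `m + k` is followed by the change of request to `m + k + 1`. The total
variation loss cancels part of the gain L, and summing over all m makes what remains the same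
multiple of `overlap` for every shift k. -/
theorem sum_answerEnt_step [NeZero M] [Nonempty V] (hn : 1 ≤ n)
    {p : Fin M → (∀ l, Query l) → ℝ}
    (hp : ∀ m r, 0 ≤ p m r) (hp1 : ∀ m, ∑ r, p m r = 1)
    (hap : ∀ l m q, a l m q = ∑ r : ∀ l, Query l, if r l = q then p m r else 0)
    (hret : ∀ m r, 0 < p m r →
      Finset.univ.inf (fun l => ans l (r l)) ≤ Setoid.ker fun x : Fin M → V => x m)
    (ha1 : ∀ l m, ∑ q, a l m q = 1)
    (hans : ∀ l q t, condEnt (ans l q) t ≤ Real.log (Fintype.card V))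
    (K : Fin M → Finset (Fin M)) (k : Fin M) (hK : ∀ m, m + k ∉ K m) :
    M * Real.log (Fintype.card V) * overlap a +
      (∑ m, answerEnt ans a (insert (m + k) (K m)) (m + k + 1)) / n ≤
      ∑ m, answerEnt ans a (K m) (m + k) := by
  have hn' : (0 : ℝ) < n := by exact_mod_cast hn
  have hM' : (M : ℝ) ≠ 0 := by exact_mod_cast NeZero.ne M
  have h1 : ∀ m, Real.log (Fintype.card V) + (answerEnt ans a (insert (m + k) (K m)) (m + k + 1) -
      Real.log (Fintype.card V) * ∑ l, (1 - ∑ q, min (a l (m + k) q) (a l (m + k + 1) q))) / n ≤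
      answerEnt ans a (K m) (m + k) := by
    intro m
    refine le_trans ?_ (le_answerEnt hn hp hp1 hap hret (hK m))
    gcongr
    exact answerEnt_sub_le ha1 hans _ _ _
  refine le_trans (le_of_eq ?_) (Finset.sum_le_sum fun m _ => h1 m)
  have h2 : ∑ m, ∑ l, ∑ q, min (a l (m + k) q) (a l (m + k + 1) q) = n * M * overlap a := by
    rw [overlap, mul_div_cancel₀ _ (by positivity), Finset.sum_comm]
    exact Finset.sum_congr rfl fun l _ =>
      Equiv.sum_comp (Equiv.addRight k) fun m => ∑ q, min (a l m q) (a l (m + 1) q)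
  rw [Finset.sum_add_distrib, ← Finset.sum_div, Finset.sum_sub_distrib, ← Finset.mul_sum]
  simp only [Finset.sum_sub_distrib, h2, Finset.sum_const, Finset.card_univ, Fintype.card_fin,
    nsmul_eq_mul, mul_one]
  field_simp
  ring

/-- The converse bound for the sum of the entropies of the answers in terms of the overlap. -/
theorem overlap_bound_le_sum_answerEnt [NeZero M] [Nonempty V] (hn : 1 ≤ n)
    {p : Fin M → (∀ l, Query l) → ℝ}
    (hp : ∀ m r, 0 ≤ p m r) (hp1 : ∀ m, ∑ r, p m r = 1)
    (hap : ∀ l m q, a l m q = ∑ r : ∀ l, Query l, if r l = q then p m r else 0)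
    (hret : ∀ m r, 0 < p m r →
      Finset.univ.inf (fun l => ans l (r l)) ≤ Setoid.ker fun x : Fin M → V => x m)
    (ha1 : ∀ l m, ∑ q, a l m q = 1)
    (hans : ∀ l q t, condEnt (ans l q) t ≤ Real.log (Fintype.card V)) :
    M * Real.log (Fintype.card V) *
      (1 / (n : ℝ) ^ (M - 1) + ∑ j ∈ Finset.range (M - 1), 1 / (n : ℝ) ^ j * overlap a) ≤
      ∑ m, answerEnt ans a ∅ m := by
  have hn' : (0 : ℝ) < n := by exact_mod_cast hn
  have ha : ∀ l m q, 0 ≤ a l m q := fun l m q => by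
    rw [hap]
    exact Finset.sum_nonneg fun r _ => by split_ifs <;> simp [hp]
  -- The k files retrieved so far, starting from m in cyclic order.
  let K : ℕ → Fin M → Finset (Fin M) := fun k m =>
    (Finset.range k).image fun j => m + Fin.ofNat M j
  have hK : ∀ k < M, ∀ m, m + Fin.ofNat M k ∉ K k m := by
    intro k hk m hm
    obtain ⟨j, hj, hjk⟩ := Finset.mem_image.1 hm
    have h1 := congrArg Fin.val (add_left_cancel hjk)
    have hj' := Finset.mem_range.1 hj
    simp only [Fin.ofNat_eq_cast, Fin.val_natCast] at h1
    rw [Nat.mod_eq_of_lt hk, Nat.mod_eq_of_lt (hj'.trans hk)] at h1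
    omega
  have hKs : ∀ k m, K (k + 1) m = insert (m + Fin.ofNat M k) (K k m) := fun k m => by
    simp only [K, Finset.range_add_one, Finset.image_insert]
  have hs : ∀ (k : ℕ) (m : Fin M), m + Fin.ofNat M k + 1 = m + Fin.ofNat M (k + 1) := by
    intro k m
    rw [add_assoc]
    congr 1
    exact Fin.ext (by simp [Fin.val_add, Nat.add_mod])
  -- Induction on the number d of changes of request still to come. At d = 0 only the last file is
  -- unknown, and its retrieval gives L without any overlap factor.
  have main : ∀ d k, k + d + 1 = M → M * Real.log (Fintype.card V) *
      (1 / (n : ℝ) ^ d + ∑ j ∈ Finset.range d, 1 / (n : ℝ) ^ j * overlap a) ≤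
      ∑ m, answerEnt ans a (K k m) (m + Fin.ofNat M k) := by
    intro d
    induction d with
    | zero =>
      intro k hk
      have : ∑ _m : Fin M, Real.log (Fintype.card V) ≤
          ∑ m, answerEnt ans a (K k m) (m + Fin.ofNat M k) := by
        refine Finset.sum_le_sum fun m _ => ?_
        refine le_trans ?_ (le_answerEnt hn hp hp1 hap hret (hK k (by omega) m))
        exact le_add_of_nonneg_right (div_nonneg (answerEnt_nonneg ha _ _) hn'.le)
      simpa using this
    | succ d ih =>
      intro k hk
      refine le_trans ?_ (sum_answerEnt_step hn hp hp1 hap hret ha1 hans (K k)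
        (Fin.ofNat M k) (hK k (by omega)))
      simp only [hs, ← hKs]
      have := div_le_div_of_nonneg_right (ih (k + 1) (by omega)) hn'.le
      refine le_trans (le_of_eq ?_) (add_le_add_right this _)
      -- Division by n raises every exponent of the inductive bound by one; the new overlap term is
      -- the one with j = 0.
      rw [Finset.sum_range_succ', ← Finset.sum_mul, ← Finset.sum_mul]
      have h3 : ∑ i ∈ Finset.range d, 1 / (n : ℝ) ^ (i + 1) =
          (∑ i ∈ Finset.range d, 1 / (n : ℝ) ^ i) / n := by
        rw [Finset.sum_div]
        exact Finset.sum_congr rfl fun i _ => by rw [pow_succ, div_div]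
      rw [h3]
      field_simp
      ring
  have h0 := main (M - 1) 0 (by have := NeZero.pos M; omega)
  simpa [K, Fin.ofNat_eq_cast] using h0

end Converse

/-! ### Leakage against overlap -/

section Leakage

/-- Jensen for `negMulLog`, in the unnormalized form of H(J | Q = q) ≤ log M. Here `s` lists the
masses of the M edges, counted with total 2P since each request lies on two edges. -/
theorem negMulLog_sum_ge {M : ℕ} (hM : 1 ≤ M) {ι : Type*} [Fintype ι] (hι : Fintype.card ι = M)
    {s : ι → ℝ} (hs : ∀ i, 0 ≤ s i) {P : ℝ} (hP : ∑ i, s i = 2 * P) :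
    (∑ i, Real.negMulLog (s i)) / 2 ≤ Real.negMulLog P + P * (Real.log M - Real.log 2) := by
  have hM' : (0 : ℝ) < M := by exact_mod_cast hM
  have h := Real.concaveOn_negMulLog.le_map_sum (t := Finset.univ) (w := fun _ : ι => (1 / M : ℝ))
    (p := s) (fun i _ => by positivity) (by simp [hι, hM'.ne']) (fun i _ => hs i)
  simp only [smul_eq_mul, ← Finset.mul_sum, hP] at h
  have h2 : Real.negMulLog (1 / M * (2 * P)) =
      (2 / M) * (Real.negMulLog P + P * (Real.log M - Real.log 2)) := by
    rcases eq_or_ne P 0 with rfl | h0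
    · simp
    · rw [show (1 / M * (2 * P) : ℝ) = (2 / M) * P by ring, Real.negMulLog_mul]
      simp only [Real.negMulLog]
      rw [Real.log_div (by norm_num) hM'.ne']
      ring
  rw [h2] at h
  have := mul_le_mul_of_nonneg_left h hM'.le
  field_simp at this
  linarith

/-- The grouping rule for two masses. Symmetry of the binary entropy allows the smaller posterior as
its argument, so that averaging produces the overlap. -/
theorem mul_binEntropy_min_div {x y : ℝ} (hx : 0 ≤ x) (hy : 0 ≤ y) :
    (x + y) * Real.binEntropy (min x y / (x + y)) =
      Real.negMulLog x + Real.negMulLog y - Real.negMulLog (x + y) := by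
  have key : ∀ {x y : ℝ}, 0 ≤ x → 0 ≤ y → (x + y) * Real.binEntropy (x / (x + y)) =
      Real.negMulLog x + Real.negMulLog y - Real.negMulLog (x + y) := by
    intro x y hx hy
    rcases hx.eq_or_lt with rfl | hx
    · simp
    rcases hy.eq_or_lt with rfl | hy
    · simp [hx.ne']
    have h1 : 1 - x / (x + y) = y / (x + y) := by field_simp; ring
    rw [Real.binEntropy_eq_negMulLog_add_negMulLog_one_sub, h1]
    simp only [Real.negMulLog]
    rw [Real.log_div hx.ne' (by positivity), Real.log_div hy.ne' (by positivity)]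
    field_simp
    ring
  rcases le_total x y with h | h
  · rw [min_eq_left h, key hx hy]
  · rw [min_eq_right h, add_comm x y, key hy hx, add_comm (Real.negMulLog x)]

variable {M n : ℕ} {Query : Fin n → Type*} [∀ l, Fintype (Query l)]

/-- The average binary entropy of the posterior of a uniform choice between two cyclically
consecutive requests is at most the binary entropy of half the overlap. -/
theorem sum_negMulLog_le_binEntropy_overlap [NeZero M] (hn : 1 ≤ n)
    {a : ∀ l, Fin M → Query l → ℝ} (ha : ∀ l m q, 0 ≤ a l m q)
    (ha1 : ∀ l m, ∑ q, a l m q = 1) :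
    (∑ l, ∑ m, ∑ q, (Real.negMulLog (a l m q / M) + Real.negMulLog (a l (m + 1) q / M) -
      Real.negMulLog (a l m q / M + a l (m + 1) q / M))) / (2 * n) ≤
      Real.binEntropy (overlap a / 2) := by
  have hn' : (0 : ℝ) < n := by exact_mod_cast hn
  have hM' : (0 : ℝ) < M := by exact_mod_cast NeZero.pos M
  have hc : ∀ l m q, 0 ≤ a l m q / M := fun l m q => div_nonneg (ha l m q) hM'.le
  -- The weights are the joint law of a uniform server, a uniform edge and the query, the request
  -- being a uniform endpoint of the edge; the points are the smaller posteriors of the two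
  -- endpoints.
  have hJ := Real.strictConcave_binEntropy.concaveOn.le_map_sum
    (t := Finset.univ (α := Σ x : Fin n × Fin M, Query x.1))
    (w := fun x => (a x.1.1 x.1.2 x.2 / M + a x.1.1 (x.1.2 + 1) x.2 / M) / (2 * n))
    (p := fun x => min (a x.1.1 x.1.2 x.2 / M) (a x.1.1 (x.1.2 + 1) x.2 / M) /
      (a x.1.1 x.1.2 x.2 / M + a x.1.1 (x.1.2 + 1) x.2 / M))
    (fun x _ => div_nonneg (add_nonneg (hc _ _ _) (hc _ _ _)) (by positivity))
    (by
      simp only [Fintype.sum_sigma, Fintype.sum_prod_type, ← Finset.sum_div,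
        Finset.sum_add_distrib, ha1]
      simp only [Finset.sum_const, Finset.card_univ, Fintype.card_fin, nsmul_eq_mul]
      field_simp
      norm_num)
    (fun x _ => by
      refine ⟨div_nonneg (le_min (hc _ _ _) (hc _ _ _)) (add_nonneg (hc _ _ _) (hc _ _ _)),
        div_le_one_of_le₀ ?_ (add_nonneg (hc _ _ _) (hc _ _ _))⟩
      exact (min_le_left _ _).trans (le_add_of_nonneg_right (hc _ _ _)))
  simp only [smul_eq_mul] at hJ
  refine le_trans (le_of_eq ?_) (hJ.trans (le_of_eq ?_))
  · simp only [Fintype.sum_sigma, Fintype.sum_prod_type, Finset.sum_div]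
    refine Finset.sum_congr rfl fun l _ => Finset.sum_congr rfl fun m _ =>
      Finset.sum_congr rfl fun q _ => ?_
    rw [← mul_binEntropy_min_div (hc _ _ _) (hc _ _ _)]
    ring
  · congr 1
    simp only [Fintype.sum_sigma, Fintype.sum_prod_type, overlap, Finset.sum_div]
    refine Finset.sum_congr rfl fun l _ => Finset.sum_congr rfl fun m _ =>
      Finset.sum_congr rfl fun q _ => ?_
    have hmin : min (a l m q / M) (a l (m + 1) q / M) = min (a l m q) (a l (m + 1) q) / M :=
      (min_div_div_right hM'.le _ _)
    -- If both masses vanish, the posterior is 0 / 0 = 0 and both sides are zero.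
    rcases (add_nonneg (hc l m q) (hc l (m + 1) q)).eq_or_lt with h0 | h0
    · have h1 : a l m q / M = 0 := by linarith [hc l m q, hc l (m + 1) q]
      have h2 : a l (m + 1) q / M = 0 := by linarith [hc l m q, hc l (m + 1) q]
      have h1' : a l m q = 0 := by simpa [hM'.ne'] using h1
      have h2' : a l (m + 1) q = 0 := by simpa [hM'.ne'] using h2
      simp [h1', h2']
    · rw [div_mul_div_comm, mul_comm (2 * (n : ℝ)), mul_div_mul_left _ _ h0.ne', hmin]
      field_simp

/-- This is H(index | J, Q) ≥ log 2 - I(index ; Q), averaged over the servers. The cyclic shift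
makes both endpoints contribute the same entropy sum, and `negMulLog_sum_ge` controls the entropy of
the edge. -/
theorem log_two_sub_le_binEntropy_overlap [NeZero M] (hn : 1 ≤ n)
    {a : ∀ l, Fin M → Query l → ℝ} (ha : ∀ l m q, 0 ≤ a l m q)
    (ha1 : ∀ l m, ∑ q, a l m q = 1) :
    Real.log 2 - (∑ l, (Real.log M - ∑ q, (∑ m, Real.negMulLog (a l m q / M) -
      Real.negMulLog (∑ m, a l m q / M)))) / n ≤ Real.binEntropy (overlap a / 2) := by
  have hn' : (0 : ℝ) < n := by exact_mod_cast hn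
  have hM' : (0 : ℝ) < M := by exact_mod_cast NeZero.pos M
  refine le_trans ?_ (sum_negMulLog_le_binEntropy_overlap hn ha ha1)
  have hshift : ∀ f : Fin M → ℝ, ∑ m, f (m + 1) = ∑ m, f m := fun f =>
    Equiv.sum_comp (Equiv.addRight (1 : Fin M)) f
  have h1 : ∀ l, ∑ q, (∑ m, Real.negMulLog (a l m q / M) - Real.negMulLog (∑ m, a l m q / M)) -
      (Real.log M - Real.log 2) ≤
      (∑ m, ∑ q, (Real.negMulLog (a l m q / M) + Real.negMulLog (a l (m + 1) q / M) -
      Real.negMulLog (a l m q / M + a l (m + 1) q / M))) / 2 := by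
    intro l
    have hP : ∑ q, ∑ m, a l m q / M = 1 := by
      rw [Finset.sum_comm]
      simp [← Finset.sum_div, ha1, hM'.ne']
    rw [Finset.sum_comm (s := Finset.univ (α := Fin M)), ← one_mul (Real.log M - Real.log 2), ← hP,
      Finset.sum_mul, ← Finset.sum_sub_distrib, Finset.sum_div]
    refine Finset.sum_le_sum fun q _ => ?_
    have h2 := negMulLog_sum_ge (NeZero.one_le (n := M)) (Fintype.card_fin M)
      (s := fun m => a l m q / M + a l (m + 1) q / M) (P := ∑ m, a l m q / M)
      (fun m => add_nonneg (div_nonneg (ha l m q) hM'.le) (div_nonneg (ha l (m + 1) q) hM'.le))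
      (by rw [Finset.sum_add_distrib, hshift fun m => a l m q / M]; ring)
    rw [Finset.sum_sub_distrib, Finset.sum_add_distrib,
      hshift fun m => Real.negMulLog (a l m q / M)]
    linarith
  have h2 := Finset.sum_le_sum fun l (_ : l ∈ Finset.univ) => h1 l
  rw [← Finset.sum_div, Finset.sum_sub_distrib] at h2
  simp only [Finset.sum_const, Finset.card_univ, Fintype.card_fin, nsmul_eq_mul] at h2
  rw [Finset.sum_sub_distrib]
  simp only [Finset.sum_const, Finset.card_univ, Fintype.card_fin, nsmul_eq_mul]
  have h3 := div_le_div_of_nonneg_right h2 hn'.le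
  refine le_trans (le_of_eq ?_) (h3.trans (le_of_eq ?_))
  · field_simp
    ring
  · field_simp

theorem overlap_mem_Icc [NeZero M] (hn : 1 ≤ n) {a : ∀ l, Fin M → Query l → ℝ}
    (ha : ∀ l m q, 0 ≤ a l m q) (ha1 : ∀ l m, ∑ q, a l m q = 1) :
    0 ≤ overlap a ∧ overlap a ≤ 1 := by
  have hn' : (0 : ℝ) < n := by exact_mod_cast hn
  have hM' : (0 : ℝ) < M := by exact_mod_cast NeZero.pos M
  refine ⟨div_nonneg (Finset.sum_nonneg fun l _ => Finset.sum_nonneg fun m _ =>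
    Finset.sum_nonneg fun q _ => le_min (ha _ _ _) (ha _ _ _)) (by positivity), ?_⟩
  refine div_le_one_of_le₀ ?_ (by positivity)
  calc _ ≤ ∑ l : Fin n, ∑ m : Fin M, ∑ q, a l m q :=
        Finset.sum_le_sum fun l _ => Finset.sum_le_sum fun m _ =>
          Finset.sum_le_sum fun q _ => min_le_left _ _
    _ = n * M := by simp [ha1]

end Leakage

/-! ### Discrete entropies as finite sums -/

section Discrete

variable {Ω : Type*} [MeasurableSpace Ω]

/-- Measurable fibers suffice; the set `B` is arbitrary. -/
theorem measureReal_eq_sum_inter_fiber (P : Measure Ω) [IsFiniteMeasure P] {𝒴 : Type*} [Fintype 𝒴]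
    {Y : Ω → 𝒴} (hY : ∀ y, MeasurableSet (Y ⁻¹' {y})) (B : Set Ω) :
    P.real B = ∑ y, P.real (Y ⁻¹' {y} ∩ B) := by
  have := sum_measureReal_preimage_singleton (μ := P.restrict B) Finset.univ
    (f := Y) (fun y _ => hY y)
  simp only [measureReal_restrict_apply (hY _), Finset.coe_univ, Set.preimage_univ,
    measureReal_restrict_apply MeasurableSet.univ, Set.univ_inter] at this
  exact this.symm

/-- All terms are nonnegative, so each vanishes, and `negMulLog` has no zero in [0, 1] other than 0
and 1. -/
theorem condEntropy_eq_zero_imp {P : Measure Ω} [IsFiniteMeasure P] {𝒴 𝒵 : Type*} [Fintype 𝒴]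
    {Y : Ω → 𝒴} {Z : Ω → 𝒵} (hZ : (Set.range Z).Finite) (h : condEntropy P Y Z = 0) (y : 𝒴)
    {z : 𝒵} (hz : 0 < P.real (Z ⁻¹' {z})) (hy : 0 < P.real (Y ⁻¹' {y} ∩ Z ⁻¹' {z})) :
    P.real (Y ⁻¹' {y} ∩ Z ⁻¹' {z}) = P.real (Z ⁻¹' {z}) := by
  have hle : ∀ y z, P.real (Y ⁻¹' {y} ∩ Z ⁻¹' {z}) ≤ P.real (Z ⁻¹' {z}) := fun y z =>
    measureReal_mono Set.inter_subset_right
  have h0 : ∀ y z, 0 ≤ Real.negMulLog (P.real (Y ⁻¹' {y} ∩ Z ⁻¹' {z}) / P.real (Z ⁻¹' {z})) /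
      Real.log 2 := fun y z =>
    div_nonneg (Real.negMulLog_nonneg (by positivity)
      (div_le_one_of_le₀ (hle y z) measureReal_nonneg)) (Real.log_nonneg (by norm_num))
  have hzr : z ∈ hZ.toFinset := by
    rw [Set.Finite.mem_toFinset]
    by_contra hzr
    have : Z ⁻¹' {z} = ∅ := by
      ext ω
      simp only [Set.mem_preimage, Set.mem_singleton_iff, Set.mem_empty_iff_false, iff_false]
      exact fun hω => hzr ⟨ω, hω⟩
    simp [this] at hz
  rw [condEntropy, tsum_eq_sum (s := hZ.toFinset)] at h
  · rw [Finset.sum_eq_zero_iff_of_nonneg fun z _ => mul_nonneg measureReal_nonneg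
      (tsum_nonneg fun y => h0 y z)] at h
    have h1 := (mul_eq_zero.1 (h z hzr)).resolve_left hz.ne'
    rw [tsum_fintype, Finset.sum_eq_zero_iff_of_nonneg fun y _ => h0 y z] at h1
    have h2 := h1 y (Finset.mem_univ y)
    have hpos := div_pos hy hz
    rw [div_eq_zero_iff, or_iff_left (Real.log_pos (by norm_num)).ne', Real.negMulLog,
      mul_eq_zero, neg_eq_zero, or_iff_right hpos.ne'] at h2
    exact (div_eq_one_iff_eq hz.ne').1 (Real.eq_one_of_pos_of_log_eq_zero hpos h2)
  · intro z hz
    have : Z ⁻¹' {z} = ∅ := by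
      ext ω
      simp only [Set.mem_preimage, Set.mem_singleton_iff, Set.mem_empty_iff_false, iff_false]
      exact fun hω => hz (by simpa using ⟨ω, hω⟩)
    simp [this]

theorem sum_mul_negMulLog_div {ι : Type*} [Fintype ι] {c : ι → ℝ} (hc : ∀ i, 0 ≤ c i) :
    (∑ i, c i) * ∑ i, Real.negMulLog (c i / ∑ j, c j) =
      ∑ i, Real.negMulLog (c i) - Real.negMulLog (∑ i, c i) := by
  rcases (Finset.sum_nonneg fun i (_ : i ∈ Finset.univ) => hc i).eq_or_lt with h0 | h0
  · have h1 := (Finset.sum_eq_zero_iff_of_nonneg fun i _ => hc i).1 h0.symm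
    simp [fun i => h1 i (Finset.mem_univ i)]
  · rw [Finset.mul_sum]
    have : ∀ i, (∑ j, c j) * Real.negMulLog (c i / ∑ j, c j) =
        Real.negMulLog (c i) + c i * Real.log (∑ j, c j) := by
      intro i
      rcases (hc i).eq_or_lt with h | h
      · simp [← h]
      · simp only [Real.negMulLog]
        rw [Real.log_div h.ne' h0.ne']
        field_simp
        ring
    rw [Finset.sum_congr rfl fun i _ => this i, Finset.sum_add_distrib, ← Finset.sum_mul]
    simp only [Real.negMulLog]
    ring

end Discrete

/-! ### Query laws, answers and costs of a protocol -/

instance (𝒳 : Type v) (M β : ℕ) [Finite 𝒳] : Finite (Files 𝒳 M β) :=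
  inferInstanceAs (Finite (Fin M → Fin β → 𝒳))

instance (𝒳 : Type v) (M β : ℕ) [Nonempty 𝒳] : Nonempty (Files 𝒳 M β) :=
  inferInstanceAs (Nonempty (Fin M → Fin β → 𝒳))

instance (𝒳 : Type v) (M β : ℕ) : MeasurableSingletonClass (Files 𝒳 M β) :=
  ⟨fun _ => trivial⟩

namespace IRProtocol

variable {𝒳 : Type v} {M n β : ℕ} (C : IRProtocol.{u} 𝒳 M n β)

/-- The probability of the query `q` to server `l`, for the request of file `m`. -/
noncomputable def queryProb (l : Fin n) (m : Fin M) (q : C.Query l) : ℝ :=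
  C.law.real {s | C.query l m s = q}

/-- The joint probability of the queries `r`, for the request of file `m`. -/
noncomputable def jointProb (m : Fin M) (r : ∀ l, C.Query l) : ℝ :=
  C.law.real {s | (fun l => C.query l m s) = r}

theorem measurableSet_queries (m : Fin M) (r : ∀ l, C.Query l) :
    MeasurableSet {s | (fun l => C.query l m s) = r} := by
  have : {s | (fun l => C.query l m s) = r} = ⋂ l, {s | C.query l m s = r l} := by
    ext s
    simp [funext_iff]
  rw [this]
  exact MeasurableSet.iInter fun l => C.measurableSet_query l m (r l)

theorem queryProb_nonneg (l : Fin n) (m : Fin M) (q : C.Query l) : 0 ≤ C.queryProb l m q :=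
  measureReal_nonneg

theorem jointProb_nonneg (m : Fin M) (r : ∀ l, C.Query l) : 0 ≤ C.jointProb m r :=
  measureReal_nonneg

theorem sum_queryProb (l : Fin n) (m : Fin M) : ∑ q, C.queryProb l m q = 1 := by
  have := measureReal_eq_sum_inter_fiber C.law (Y := C.query l m)
    (fun q => C.measurableSet_query l m q) Set.univ
  simp only [probReal_univ, Set.inter_univ] at this
  exact this.symm

open Classical in
theorem sum_jointProb (m : Fin M) : ∑ r, C.jointProb m r = 1 := by
  have := measureReal_eq_sum_inter_fiber C.law (Y := fun s l => C.query l m s)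
    (fun r => C.measurableSet_queries m r) Set.univ
  simp only [probReal_univ, Set.inter_univ] at this
  exact this.symm

open Classical in
theorem queryProb_eq_sum_jointProb (l : Fin n) (m : Fin M) (q : C.Query l) :
    C.queryProb l m q = ∑ r : ∀ l, C.Query l, if r l = q then C.jointProb m r else 0 := by
  rw [queryProb, measureReal_eq_sum_inter_fiber C.law (Y := fun s l => C.query l m s)
    (fun r => C.measurableSet_queries m r)]
  refine Finset.sum_congr rfl fun r _ => ?_
  split_ifs with h
  · congr 1
    ext s
    simp only [Set.mem_inter_iff, Set.mem_preimage, Set.mem_singleton_iff, Set.mem_ofPred_eq,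
      and_iff_left_iff_imp]
    rintro rfl
    exact h
  · have : (fun s l => C.query l m s) ⁻¹' {r} ∩ {s | C.query l m s = q} = ∅ := by
      ext s
      simp only [Set.mem_inter_iff, Set.mem_preimage, Set.mem_singleton_iff, Set.mem_ofPred_eq,
        Set.mem_empty_iff_false, iff_false, not_and]
      rintro rfl
      exact h
    simp [this]

theorem measurableSet_index (m : Fin M) : MeasurableSet (C.index ⁻¹' {m}) :=
  measurable_fst (measurableSet_singleton m)

theorem measurableSet_Q (l : Fin n) (q : C.Query l) : MeasurableSet (C.Q l ⁻¹' {q}) := by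
  have : C.Q l ⁻¹' {q} =
      ⋃ m, {m} ×ˢ {s | C.query l m s = q} ×ˢ (Set.univ : Set (Files 𝒳 M β)) := by
    ext ⟨m, s, x⟩
    simp [Q]
  rw [this]
  exact MeasurableSet.iUnion fun m => (measurableSet_singleton m).prod
    ((C.measurableSet_query l m q).prod MeasurableSet.univ)

/-- The partition of the contents of the database according to the answer of server `l` to `q`. -/
def answerSetoid (l : Fin n) (q : C.Query l) : Setoid (Fin M → Fin β → 𝒳) :=
  Setoid.ker fun x : Fin M → Fin β → 𝒳 => C.answer l q x

/-- The length is determined by the query, so the answer is one of |Symbol| ^ length words. -/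
theorem condEnt_answerSetoid_le_length [Fintype 𝒳] [Nonempty 𝒳] (l : Fin n) (q : C.Query l)
    (t : Setoid (Fin M → Fin β → 𝒳)) :
    condEnt (C.answerSetoid l q) t ≤
      C.answerLength l q * Real.log (Fintype.card C.Symbol) := by
  rw [← Real.log_pow, ← Nat.cast_pow]
  refine condEnt_ker_le_log _ t _ ?_
  have hsub : Set.range (fun x : Fin M → Fin β → 𝒳 => C.answer l q x) ⊆
      Set.range (List.Vector.toList : List.Vector C.Symbol (C.answerLength l q) → _) := by
    rintro _ ⟨x, rfl⟩
    exact ⟨⟨_, C.length_answer l q x⟩, rfl⟩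
  have : Finite (List.Vector C.Symbol (C.answerLength l q)) :=
    Finite.of_fintype (List.Vector C.Symbol (C.answerLength l q))
  refine (Set.ncard_le_ncard hsub (Set.finite_range _)).trans ?_
  rw [← card_vector, ← Nat.card_eq_fintype_card, ← Set.ncard_univ, ← Set.image_univ]
  exact Set.ncard_image_le Set.finite_univ

theorem condEnt_answerSetoid_le_log [Fintype 𝒳] [Nonempty 𝒳] (l : Fin n)
    (h : (C.answerAlphabet l).encard ≤ ((Fintype.card 𝒳 ^ β : ℕ) : ℕ∞)) (q : C.Query l)
    (t : Setoid (Fin M → Fin β → 𝒳)) :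
    condEnt (C.answerSetoid l q) t ≤ Real.log (Fintype.card (Fin β → 𝒳)) := by
  refine condEnt_ker_le_log _ t _ ?_
  have hsub : Set.range (fun x : Fin M → Fin β → 𝒳 => C.answer l q x) ⊆ C.answerAlphabet l := by
    rintro _ ⟨x, rfl⟩
    exact ⟨q, x, rfl⟩
  rw [Set.ncard_def, Fintype.card_fun, Fintype.card_fin]
  exact ENat.toNat_le_of_le_natCast ((Set.encard_le_encard hsub).trans h)

theorem prob_real_prod [Finite 𝒳] [Nonempty 𝒳] (m : Fin M) (T : Set C.Strategy) (B : Set (Files 𝒳 M β)) :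
    C.prob.real ({m} ×ˢ T ×ˢ B) =
      C.law.real T * (uniformOn (Set.univ : Set (Files 𝒳 M β))).real B / M := by
  have : IsProbabilityMeasure (uniformOn (Set.univ : Set (Files 𝒳 M β))) :=
    isProbabilityMeasure_uniformOn Set.finite_univ Set.univ_nonempty
  have h : (uniformOn (Set.univ : Set (Fin M))).real {m} = 1 / M := by
    simp [Measure.real, uniformOn_univ]
  rw [prob, measureReal_prod_prod, measureReal_prod_prod, h]
  ring

theorem prob_index_inter_query [Finite 𝒳] [Nonempty 𝒳] (l : Fin n) (m : Fin M) (q : C.Query l) :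
    C.prob.real (C.index ⁻¹' {m} ∩ C.Q l ⁻¹' {q}) = C.queryProb l m q / M := by
  have : IsProbabilityMeasure (uniformOn (Set.univ : Set (Files 𝒳 M β))) :=
    isProbabilityMeasure_uniformOn Set.finite_univ Set.univ_nonempty
  have h : C.index ⁻¹' {m} ∩ C.Q l ⁻¹' {q} =
      {m} ×ˢ {s | C.query l m s = q} ×ˢ (Set.univ : Set (Files 𝒳 M β)) := by
    ext ⟨m', s, x⟩
    simp only [index, Q, Set.mem_inter_iff, Set.mem_preimage, Set.mem_singleton_iff, Set.mem_prod,
      Set.mem_ofPred_eq, Set.mem_univ, and_true]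
    refine and_congr_right ?_
    rintro rfl
    rfl
  rw [h, prob_real_prod, probReal_univ, mul_one, queryProb]

theorem prob_index [Finite 𝒳] [Nonempty 𝒳] (m : Fin M) : C.prob.real (C.index ⁻¹' {m}) = 1 / M := by
  have : IsProbabilityMeasure (uniformOn (Set.univ : Set (Files 𝒳 M β))) :=
    isProbabilityMeasure_uniformOn Set.finite_univ Set.univ_nonempty
  have h : C.index ⁻¹' {m} =
      {m} ×ˢ (Set.univ : Set C.Strategy) ×ˢ (Set.univ : Set (Files 𝒳 M β)) := by
    ext ⟨m', s, x⟩
    simp [index]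
  rw [h, prob_real_prod, probReal_univ, probReal_univ, mul_one]

variable [Nonempty 𝒳] [NeZero M]

section

variable [Finite 𝒳]

instance : IsProbabilityMeasure C.prob := by
  have : IsProbabilityMeasure (uniformOn (Set.univ : Set (Fin M))) :=
    isProbabilityMeasure_uniformOn Set.finite_univ Set.univ_nonempty
  have : IsProbabilityMeasure (uniformOn (Set.univ : Set (Files 𝒳 M β))) :=
    isProbabilityMeasure_uniformOn Set.finite_univ Set.univ_nonempty
  unfold prob
  infer_instance

theorem prob_query (l : Fin n) (q : C.Query l) :
    C.prob.real (C.Q l ⁻¹' {q}) = ∑ m, C.queryProb l m q / M := by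
  rw [measureReal_eq_sum_inter_fiber C.prob (Y := C.index) C.measurableSet_index]
  exact Finset.sum_congr rfl fun m _ => C.prob_index_inter_query l m q

theorem mutualInfo_index_query (l : Fin n) :
    mutualInfo C.prob C.index (C.Q l) =
      (Real.log M - ∑ q, (∑ m, Real.negMulLog (C.queryProb l m q / M) -
        Real.negMulLog (∑ m, C.queryProb l m q / M))) / Real.log 2 := by
  have hM : (M : ℝ) ≠ 0 := by exact_mod_cast NeZero.ne M
  rw [mutualInfo, entropy, condEntropy, tsum_fintype, tsum_fintype, sub_div]
  congr 1
  · simp only [prob_index, Finset.sum_const, Finset.card_univ, Fintype.card_fin, nsmul_eq_mul,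
      Real.negMulLog, one_div, Real.log_inv]
    field_simp
  · rw [Finset.sum_div]
    refine Finset.sum_congr rfl fun q _ => ?_
    rw [tsum_fintype, prob_query, ← Finset.sum_div Finset.univ (fun m => Real.negMulLog _),
      ← mul_div_assoc]
    simp only [prob_index_inter_query]
    rw [sum_mul_negMulLog_div fun m => div_nonneg (C.queryProb_nonneg l m q) (Nat.cast_nonneg M)]

theorem downloadCost_eq : C.downloadCost = Real.logb 2 (Fintype.card C.Symbol) *
    ∑ l, ∑ q, (∑ m, C.queryProb l m q / M) * C.answerLength l q := by
  classical
  rw [downloadCost]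
  congr 1
  refine Finset.sum_congr rfl fun l _ => ?_
  have h : (fun ω => (C.answerLength l (C.Q l ω) : ℝ)) = fun ω =>
      ∑ q, (C.Q l ⁻¹' {q}).indicator (fun _ => (C.answerLength l q : ℝ)) ω := by
    ext ω
    simp [Set.indicator_apply]
  rw [h, integral_finsetSum _ fun q _ => (integrable_const _).indicator (C.measurableSet_Q l q)]
  refine Finset.sum_congr rfl fun q _ => ?_
  rw [integral_indicator_const _ (C.measurableSet_Q l q), prob_query, smul_eq_mul]

/-- A retrievable file is a function of the answers to all queries of positive probability. -/
theorem PerfectRetrievability.inf_answerSetoid_le {C : IRProtocol.{u} 𝒳 M n β}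
    (h : C.PerfectRetrievability) (m : Fin M) (r : ∀ l, C.Query l) (hr : 0 < C.jointProb m r) :
    Finset.univ.inf (fun l => C.answerSetoid l (r l)) ≤
      Setoid.ker fun x : Fin M → Fin β → 𝒳 => x m := by
  classical
  have := Fintype.ofFinite 𝒳
  have : IsProbabilityMeasure (uniformOn (Set.univ : Set (Files 𝒳 M β))) :=
    isProbabilityMeasure_uniformOn Set.finite_univ Set.univ_nonempty
  suffices main : ∀ x x' : Files 𝒳 M β, (∀ l, C.answer l (r l) x = C.answer l (r l) x') →
      x m = x' m from fun x x' hx => main x x' fun l =>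
    (setoid_finset_inf_iff _ _ x x').1 hx l (Finset.mem_univ l)
  intro x x' hx'
  by_contra hne
  let T : Set C.Strategy := {s | (fun l => C.query l m s) = r}
  let Z : C.Outcome → (Fin n → List C.Symbol) × (∀ l, C.Query l) × Fin M :=
    fun ω => ((fun l => C.A l ω), (fun l => C.Q l ω), C.index ω)
  let z : (Fin n → List C.Symbol) × (∀ l, C.Query l) × Fin M :=
    ((fun l => C.answer l (r l) x), r, m)
  have hZ : (Set.range Z).Finite := by
    refine (Set.finite_range fun w : Files 𝒳 M β × (∀ l, C.Query l) × Fin M =>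
      ((fun l => C.answer l (w.2.1 l) w.1), w.2.1, w.2.2)).subset ?_
    rintro _ ⟨ω, rfl⟩
    exact ⟨(ω.2.2, (fun l => C.Q l ω), C.index ω), rfl⟩
  have hpos : ∀ y : Files 𝒳 M β, 0 < C.prob.real ({m} ×ˢ T ×ˢ {y}) := by
    intro y
    have h1 : 0 < (uniformOn (Set.univ : Set (Files 𝒳 M β))).real {y} := by
      have := Fintype.ofFinite (Files 𝒳 M β)
      simp [Measure.real, uniformOn_univ, Fintype.card_pos]
    rw [prob_real_prod]
    exact div_pos (mul_pos hr h1) (by exact_mod_cast NeZero.pos M)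
  -- If y gives the same answers as x, then every outcome with request m, queries r and contents y
  -- yields the observation z.
  have hsub : ∀ y : Files 𝒳 M β, (∀ l, C.answer l (r l) x = C.answer l (r l) y) →
      {m} ×ˢ T ×ˢ {y} ⊆ C.requestedFile ⁻¹' {y m} ∩ Z ⁻¹' {z} := by
    rintro y hy ⟨m', s, w⟩ ⟨hm, hs, hw⟩
    obtain rfl : m' = m := hm
    obtain rfl : w = y := hw
    have hs' : (fun l => C.query l m' s) = r := hs
    refine ⟨rfl, ?_⟩
    simp only [Set.mem_preimage, Set.mem_singleton_iff, Z, z, Prod.mk.injEq]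
    refine ⟨?_, hs', rfl⟩
    funext l
    rw [hy l, ← hs']
    rfl
  have hU : 0 < C.prob.real (C.requestedFile ⁻¹' {x m} ∩ Z ⁻¹' {z}) :=
    (hpos x).trans_le (measureReal_mono (hsub x fun _ => rfl))
  have heq := condEntropy_eq_zero_imp hZ h (x m)
    (hU.trans_le (measureReal_mono Set.inter_subset_right)) hU
  -- Given z, the requested file equals `x m` almost surely, yet x' gives the same observation with
  -- positive probability and a different file m.
  have hdisj : Disjoint (C.requestedFile ⁻¹' {x m} ∩ Z ⁻¹' {z})
      ({m} ×ˢ T ×ˢ ({x'} : Set (Files 𝒳 M β))) := by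
    rw [Set.disjoint_left]
    rintro ω ⟨h1, -⟩ h2
    exact hne (h1.symm.trans (hsub x' hx' h2).1)
  have hmeas : MeasurableSet (({m} : Set (Fin M)) ×ˢ T ×ˢ ({x'} : Set (Files 𝒳 M β))) :=
    (measurableSet_singleton m).prod
      ((C.measurableSet_queries m r).prod (measurableSet_singleton x'))
  have hun := measureReal_union (μ := C.prob) hdisj hmeas
  have hle : C.prob.real ((C.requestedFile ⁻¹' {x m} ∩ Z ⁻¹' {z}) ∪
      {m} ×ˢ T ×ˢ ({x'} : Set (Files 𝒳 M β))) ≤ C.prob.real (Z ⁻¹' {z}) :=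
    measureReal_mono (Set.union_subset Set.inter_subset_right
      ((hsub x' hx').trans Set.inter_subset_right))
  linarith [hpos x']

/-- Half the overlap lies in [0, 1/2] and its binary entropy is at least 1 - ρ, so it belongs to the
set whose infimum defines the inverse. -/
theorem binEntropyInv_le_overlap (hn : 1 ≤ n) {ρ : ℝ} (hρ : C.leakageMI ≤ ρ) :
    2 * binEntropyInv (1 - ρ) ≤ overlap C.queryProb := by
  have hlog : 0 < Real.log 2 := Real.log_pos (by norm_num)
  have hu := overlap_mem_Icc hn C.queryProb_nonneg C.sum_queryProb
  have h := log_two_sub_le_binEntropy_overlap hn C.queryProb_nonneg C.sum_queryProb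
  have hleak : C.leakageMI = ((∑ l, (Real.log M - ∑ q, (∑ m, Real.negMulLog
      (C.queryProb l m q / M) - Real.negMulLog (∑ m, C.queryProb l m q / M)))) / n) /
      Real.log 2 := by
    simp only [leakageMI, mutualInfo_index_query, ← Finset.sum_div]
    ring
  rw [hleak, div_le_iff₀ hlog] at hρ
  have hmem : binEntropyInv (1 - ρ) ≤ overlap C.queryProb / 2 := by
    refine csInf_le ⟨0, fun p hp => hp.1⟩ ⟨by linarith [hu.1], by linarith [hu.2], ?_⟩
    rw [binEntropy₂, le_div_iff₀ hlog]
    linarith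
  linarith

end

/-- The entropy of an answer is at most its length times log |Symbol|. The factor M undoes the
averaging over the request, and log 2 converts bits to nats. -/
theorem sum_answerEnt_le_downloadCost [Fintype 𝒳] :
    ∑ m, answerEnt C.answerSetoid C.queryProb ∅ m ≤ M * Real.log 2 * C.downloadCost := by
  have hM : (M : ℝ) ≠ 0 := by exact_mod_cast NeZero.ne M
  have hlog : Real.log 2 ≠ 0 := (Real.log_pos (by norm_num)).ne'
  have h : M * Real.log 2 * C.downloadCost = ∑ m, ∑ l, ∑ q,
      C.queryProb l m q * (C.answerLength l q * Real.log (Fintype.card C.Symbol)) := by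
    rw [downloadCost_eq, Finset.sum_comm, Finset.mul_sum, Finset.mul_sum]
    refine Finset.sum_congr rfl fun l _ => ?_
    rw [Finset.sum_comm, Finset.mul_sum, Finset.mul_sum]
    refine Finset.sum_congr rfl fun q _ => ?_
    rw [← Finset.sum_mul, ← Finset.sum_div, Real.logb]
    field_simp
  rw [h]
  exact Finset.sum_le_sum fun m _ => Finset.sum_le_sum fun l _ => Finset.sum_le_sum fun q _ =>
    mul_le_mul_of_nonneg_left (C.condEnt_answerSetoid_le_length l q _) (C.queryProb_nonneg l m q)

end IRProtocol

/-- The converse bound on the download cost. -/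
theorem IRScheme.le_downloadCost {𝒳 : Type v} [Fintype 𝒳] [Nonempty 𝒳] {M n β : ℕ} [NeZero M]
    (hn : 1 ≤ n) (C : IRScheme.{u} 𝒳 M n β) {α : ℕ} (hα : C.RestrictedAlphabets α) {ρ : ℝ}
    (hρ : C.leakageMI ≤ ρ) :
    β * Real.logb 2 (Fintype.card 𝒳) * (1 / (n : ℝ) ^ (M - 1) +
      2 * ∑ m ∈ Finset.Icc 1 (M - 1), 1 / (n : ℝ) ^ (m - 1) * binEntropyInv (1 - ρ)) ≤
      C.downloadCost := by
  classical
  have hlog : 0 < Real.log 2 := Real.log_pos (by norm_num)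
  have hM' : (0 : ℝ) < M := by exact_mod_cast NeZero.pos M
  have h := (overlap_bound_le_sum_answerEnt (V := Fin β → 𝒳) (ans := C.answerSetoid) hn
    C.jointProb_nonneg C.sum_jointProb
    C.queryProb_eq_sum_jointProb C.retrievable.inf_answerSetoid_le C.sum_queryProb
    (fun l q t => C.condEnt_answerSetoid_le_log l (hα l).2 q t)).trans
    C.sum_answerEnt_le_downloadCost
  have hsum : 2 * ∑ m ∈ Finset.Icc 1 (M - 1), 1 / (n : ℝ) ^ (m - 1) * binEntropyInv (1 - ρ) ≤
      ∑ j ∈ Finset.range (M - 1), 1 / (n : ℝ) ^ j * overlap C.queryProb := by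
    have hIcc : Finset.Icc 1 (M - 1) = Finset.Ico 1 M := by
      ext i
      have := NeZero.pos M
      simp only [Finset.mem_Icc, Finset.mem_Ico]
      omega
    rw [hIcc, Finset.sum_Ico_eq_sum_range, Finset.mul_sum]
    refine Finset.sum_le_sum fun j _ => ?_
    rw [Nat.add_sub_cancel_left, mul_left_comm]
    exact mul_le_mul_of_nonneg_left (C.binEntropyInv_le_overlap hn hρ) (by positivity)
  rw [Fintype.card_fun, Fintype.card_fin, Nat.cast_pow, Real.log_pow, mul_assoc, mul_assoc,
    mul_assoc, mul_le_mul_iff_of_pos_left hM', ← mul_assoc] at h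
  have hX : 0 ≤ Real.log (Fintype.card 𝒳) := Real.log_natCast_nonneg _
  rw [Real.logb, ← mul_div_assoc, div_mul_eq_mul_div, div_le_iff₀ hlog, mul_comm C.downloadCost]
  refine le_trans ?_ h
  gcongr

theorem maxRateMI_le {𝒳 : Type v} [Fintype 𝒳] [Nontrivial 𝒳] {M n β : ℕ} (hM : 1 ≤ M)
    (hn : 1 ≤ n) (hβ : 1 ≤ β) (α : ℕ) (ρ : ℝ) :
    maxRateMI.{u, v} 𝒳 M n α ρ β ≤ ENNReal.ofReal (rateUpperBoundMI M n ρ) := by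
  have : NeZero M := ⟨by omega⟩
  refine iSup_le fun ⟨C, hα, hρ⟩ => ?_
  have h := C.le_downloadCost hn hα hρ
  have hn' : (0 : ℝ) < n := by exact_mod_cast hn
  have hH : 0 ≤ binEntropyInv (1 - ρ) := Real.sInf_nonneg fun p hp => hp.1
  have hL : 0 < β * Real.logb 2 (Fintype.card 𝒳) := mul_pos (by exact_mod_cast hβ)
    (Real.logb_pos (by norm_num) (by exact_mod_cast Fintype.one_lt_card))
  have hc : 0 < 1 / (n : ℝ) ^ (M - 1) +
      2 * ∑ m ∈ Finset.Icc 1 (M - 1), 1 / (n : ℝ) ^ (m - 1) * binEntropyInv (1 - ρ) := by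
    positivity
  -- Positivity of the cost excludes the infinite value of the rate.
  have hD : 0 < C.downloadCost := (mul_pos hL hc).trans_le h
  rw [IRProtocol.rate, ← ENNReal.ofReal_div_of_pos hD]
  refine ENNReal.ofReal_le_ofReal ?_
  rw [rateUpperBoundMI, ← one_div, div_le_div_iff₀ hD hc]
  linarith

end WPIR

theorem mainTheorem1 (𝒳 : Type v) [Fintype 𝒳] [Nontrivial 𝒳] (M n : ℕ) (hM : 1 ≤ M)
    (hn : 1 ≤ n) (α : ℕ) (ρ : ℝ) :
    (∀ β : ℕ, 1 ≤ β →
      WPIR.maxRateMI.{u, v} 𝒳 M n α ρ β ≤ ENNReal.ofReal (WPIR.rateUpperBoundMI M n ρ)) ∧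
    limsup (fun β : ℕ => WPIR.maxRateMI.{u, v} 𝒳 M n α ρ β) atTop ≤
      ENNReal.ofReal (WPIR.rateUpperBoundMI M n ρ) := by
  have h : ∀ β : ℕ, 1 ≤ β →
      WPIR.maxRateMI.{u, v} 𝒳 M n α ρ β ≤ ENNReal.ofReal (WPIR.rateUpperBoundMI M n ρ) :=
    fun β hβ => WPIR.maxRateMI_le hM hn hβ α ρ
  exact ⟨h, limsup_le_of_le (h := (eventually_ge_atTop 1).mono h)⟩
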